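/- Let $K\ge 1$, let $R^*=(R^*_1,\dots,R^*_K)$ be non-negative reals such that every $2^{R^*_k}$ is an integer, and put $\mathcal I_K=\{1,\dots,K\}$. Let $p^*$ be the deterministic memoryless $K$-receiver broadcast channel whose input symbol is a tuple $(X_{\mathcal A})_{\mathcal A\subseteq\mathcal I_K}$, where $X_{\mathcal A}$ takes values in an alphabet of $2^{R^*_{|\mathcal A|}}$ elements (a single element if $\mathcal A=\emptyset$), and whose output at receiver $k$ is $Y_k=(X_{\mathcal A})_{\mathcal A\ni k}$. For a non-negative rate vector $R=(R_1,\dots,R_K)$, an $(n,R)$ symmetric broadcast code encodes mutually independent messages $W_{\mathcal A}$, $\mathcal A\subseteq\mathcal I_K$, where $W_{\mathcal A}$ is uniform on a set of $\lceil 2^{nR_{|\mathcal A|}}\rceil$ elements (with $R_0=0$), into $n$ input symbols; from its $n$ output symbols, receiver $k$ estimates all $W_{\mathcal A}$ with $k\in\mathcal A$. The error probability is the probability that at least one receiver estimates at least one of its messages wrongly. The vector $R$ is achievable if there is a sequence of $(n,R)$ codes, $n\to\infty$, whose error probability tends to $0$. Let $\mathcal C_{p^*}$ be the closure of the set of achievable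 rate vectors on $p^*$. For $i,j\in\mathcal I_K$ let $$\phi_{i,j}=\binom{K-i}{j-i}^{-1}\binom{j-1}{j-i}\ (i<j),\qquad \phi_{i,j}=\binom{i}{i-j}^{-1}\binom{K-j}{i-j}\ (i>j),\qquad \phi_{i,i}=1,$$ and let $\mathcal C^*(R^*)$ be the set of $R\in\mathbb R^K$ for which there are $r_{i,j}\ge 0$ $(i,j\in\mathcal I_K)$ with $\sum_{j=1}^K r_{i,j}\le R^*_i$ for all $i$ and $0\le R_j\le\sum_{i=1}^K\phi_{i,j}r_{i,j}$ for all $j$. Then for all real numbers $A_1,\dots,A_K\ge 0$ the two maxima below exist, and $$\max_{R\in\mathcal C^*(R^*)}\ \sum_{k=1}^K A_kR_k\ \ \ge\ \max_{R\in\mathcal C_{p^*}}\ \sum_{k=1}^K A_kR_k .$$ -/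

import Mathlib

/-- Users are indexed by `Fin K`. A quantity attached to the levels `1, …, K` is a function
`v : Fin K → α`, where `v i` belongs to level `i + 1`. `byLevel d v A` is the value at
level `|A|`, and it is the default `d` at level `0`, i.e. for `A = ∅`. -/
def byLevel {K : ℕ} {α : Type} (d : α) (v : Fin K → α) (A : Finset (Fin K)) : α :=
  if h : A.Nonempty then
    v ⟨A.card - 1, by
      have h1 : 0 < A.card := h.card_pos
      have h2 : A.card ≤ K := card_finset_fin_le A
      omega⟩
  else d

/-- The exchange rate `φ_{i,j}` for `1 ≤ i, j ≤ K`. -/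
noncomputable def exchangeRate (K i j : ℕ) : ℝ :=
  if i < j then ((K - i).choose (j - i) : ℝ)⁻¹ * ((j - 1).choose (j - i) : ℝ)
  else if j < i then (i.choose (i - j) : ℝ)⁻¹ * ((K - j).choose (i - j) : ℝ)
  else 1

/-- The region `C*(R*)`. -/
def exchangeRegion {K : ℕ} (Rstar : Fin K → ℝ) : Set (Fin K → ℝ) :=
  {R | ∃ r : Fin K → Fin K → ℝ,
    (∀ i j, 0 ≤ r i j) ∧
    (∀ i, ∑ j, r i j ≤ Rstar i) ∧
    (∀ j, 0 ≤ R j ∧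
      R j ≤ ∑ i : Fin K, exchangeRate K ((i : ℕ) + 1) ((j : ℕ) + 1) * r i j)}

/-- A `K`-user broadcast channel (possibly with memory) with input alphabet `X` and discrete
output alphabets `Y k`: for every block length, the conditional law of the output blocks
given the input block. -/
structure BroadcastChannel (K : ℕ) (X : Type) (Y : Fin K → Type) where
  law : (n : ℕ) → (Fin n → X) → PMF ((k : Fin K) → Fin n → Y k)

/-- The set of values of the message `W_A` at block length `n`: it has `⌈2^(n R_{|A|})⌉`
elements, where `R_0 = 0`, so that `W_∅` is a constant. -/
abbrev MessageSet {K : ℕ} (n : ℕ) (R : Fin K → ℝ) (A : Finset (Fin K)) : Type :=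
  Fin ⌈(2 : ℝ) ^ ((n : ℝ) * byLevel 0 R A)⌉₊

/-- An `(n, R_1, …, R_K)` symmetric broadcast code: an encoder, and for each receiver `k` a
decoder for all messages `W_A` with `k ∈ A`. -/
structure SymmetricBroadcastCode (K : ℕ) (X : Type) (Y : Fin K → Type) (n : ℕ)
    (R : Fin K → ℝ) where
  enc : ((A : Finset (Fin K)) → MessageSet n R A) → Fin n → X
  dec : (k : Fin K) → (Fin n → Y k) → (A : {A : Finset (Fin K) // k ∈ A}) →
    MessageSet n R A.1

/-- The probability that at least one message is decoded wrongly by at least one receiver that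
should decode it, for independent uniform messages. -/
noncomputable def errorProb {K : ℕ} {X : Type} {Y : Fin K → Type} (P : BroadcastChannel K X Y)
    {n : ℕ} {R : Fin K → ℝ} (c : SymmetricBroadcastCode K X Y n R) : ℝ :=
  (∑ w : (A : Finset (Fin K)) → MessageSet n R A,
      ((P.law n (c.enc w)).toOuterMeasure
        {y | ∃ (k : Fin K) (A : {A : Finset (Fin K) // k ∈ A}),
          c.dec k (y k) A ≠ w A.1}).toReal) /
    (Fintype.card ((A : Finset (Fin K)) → MessageSet n R A) : ℝ)

/-- A (non-negative) rate vector is symmetrically achievable if some sequence of `(n, R)` codes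
has vanishing error probability. -/
def SymmetricallyAchievable {K : ℕ} {X : Type} {Y : Fin K → Type} (P : BroadcastChannel K X Y)
    (R : Fin K → ℝ) : Prop :=
  (∀ i, 0 ≤ R i) ∧
  ∃ c : (n : ℕ) → SymmetricBroadcastCode K X Y n R,
    Filter.Tendsto (fun n => errorProb P (c n)) Filter.atTop (nhds 0)

/-- The symmetric broadcast capacity region. -/
def capacityRegion {K : ℕ} {X : Type} {Y : Fin K → Type} (P : BroadcastChannel K X Y) :
    Set (Fin K → ℝ) :=
  closure {R | SymmetricallyAchievable P R}

/-- One input symbol of the deterministic channel: a symbol `X_A` for each set `A` of users, with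
an alphabet of `q_{|A|}` elements (and one element for `A = ∅`). -/
abbrev DetInput {K : ℕ} (q : Fin K → ℕ) : Type :=
  (A : Finset (Fin K)) → Fin (byLevel 1 q A)

/-- One output symbol at receiver `k`: the symbols `X_A` with `k ∈ A`. -/
abbrev DetOutput {K : ℕ} (q : Fin K → ℕ) (k : Fin K) : Type :=
  (A : {A : Finset (Fin K) // k ∈ A}) → Fin (byLevel 1 q A.1)

/-- The deterministic memoryless broadcast channel `Y_k = {X_A : k ∈ A}`. -/
noncomputable def deterministicChannel {K : ℕ} (q : Fin K → ℕ) :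
    BroadcastChannel K (DetInput q) (DetOutput q) where
  law _ x := PMF.pure (fun _ t A => x t A.1)

/-! Both sides are compared through one weighting of levels. Write `a j = A j / K.choose (j + 1)`
and let `μ i` be the maximum over levels `j` of `min 1 (i / j)` times the entry of `a` at level `j`
(`bestExchangeValue`). By `exchangeRate_eq` the maximum over `C*` is `∑ K.choose i * μ i * R*_i`:
each `R*_i` is spent on its best target level (`isGreatest_exchangeRegion`). Since `φ_{i,i} = 1`,
each `A_i` is at most `K.choose i * μ i`, so it suffices to bound the rates in that weighting.

The weighting satisfies `μ 0 = 0`, `μ i` non-decreasing and `μ i / i` non-increasing, and every such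
weighting gives a converse (`weighted_rate_le_of_mem_capacityRegion`). Its core is
`weighted_message_entropy_le`. List the sets `A` by decreasing size and let `D A` be the entropy
which the pair (symbols, message) of `A` adds to its predecessors. Given all pairs of larger sets, a
receiver's remaining symbols determine its remaining messages, so sums of `D` over its smaller sets
are at most the symbol entropies. On initial segments, sums of `D` are at least the message
entropies. Summation by parts, with `μ i / i` in the first case and `μ` in the second, joins the two
bounds. -/

/-! ### Entropy of partitions under the uniform law; `⊓` is the joint variable, `≤` means
"determines". -/

section PartitionEntropy

open Classical in
/-- The number of points in the class of `ω`. -/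
noncomputable def Setoid.classCard {Ω : Type*} [Fintype Ω] (r : Setoid Ω) (ω : Ω) : ℕ :=
  (Finset.univ.filter fun ω' => r ω' ω).card

/-- `|Ω|` times the entropy (in nats) of the partition `r` under the uniform law on `Ω`. -/
noncomputable def Setoid.entropySum {Ω : Type*} [Fintype Ω] (r : Setoid Ω) : ℝ :=
  ∑ ω, Real.log ((Fintype.card Ω : ℝ) / r.classCard ω)

namespace Setoid

variable {Ω : Type*} [Fintype Ω]

theorem classCard_pos (r : Setoid Ω) (ω : Ω) : 0 < r.classCard ω :=
  Finset.card_pos.2 ⟨ω, by simp⟩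

theorem classCard_cast_pos (r : Setoid Ω) (ω : Ω) : (0 : ℝ) < r.classCard ω :=
  Nat.cast_pos.2 (r.classCard_pos ω)

theorem classCard_mono {r s : Setoid Ω} (h : r ≤ s) (ω : Ω) : r.classCard ω ≤ s.classCard ω :=
  Finset.card_le_card fun a ha => by
    simp only [Finset.mem_filter, Finset.mem_univ, true_and] at ha ⊢
    exact h ha

theorem classCard_congr (r : Setoid Ω) {a b : Ω} (h : r a b) : r.classCard a = r.classCard b := by
  unfold classCard
  congr 1
  ext c
  simp only [Finset.mem_filter, Finset.mem_univ, true_and]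
  exact ⟨fun hc => r.trans hc h, fun hc => r.trans hc (r.symm h)⟩

theorem entropySum_anti {r s : Setoid Ω} (h : r ≤ s) : s.entropySum ≤ r.entropySum := by
  refine Finset.sum_le_sum fun ω _ => ?_
  have hr := r.classCard_cast_pos ω
  have hs := s.classCard_cast_pos ω
  have hc : (0 : ℝ) < Fintype.card Ω := Nat.cast_pos.2 (Fintype.card_pos_iff.2 ⟨ω⟩)
  have : (r.classCard ω : ℝ) ≤ s.classCard ω := by exact_mod_cast classCard_mono h ω
  apply Real.log_le_log (by positivity)
  gcongr

theorem entropySum_top : (⊤ : Setoid Ω).entropySum = 0 := by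
  refine Finset.sum_eq_zero fun ω _ => ?_
  have h : (⊤ : Setoid Ω).classCard ω = Fintype.card Ω := by
    simp [classCard, Setoid.top_def]
  have hc : (Fintype.card Ω : ℝ) ≠ 0 :=
    Nat.cast_ne_zero.2 (Fintype.card_pos_iff.2 ⟨ω⟩).ne'
  rw [h, div_self hc, Real.log_one]

theorem entropySum_bot :
    (⊥ : Setoid Ω).entropySum = Fintype.card Ω * Real.log (Fintype.card Ω) := by
  have h : ∀ ω, (⊥ : Setoid Ω).classCard ω = 1 := fun ω => by
    refine Finset.card_eq_one.2 ⟨ω, ?_⟩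
    ext a
    simp [Setoid.bot_def]
  simp [entropySum, h]

/-- Submodularity of entropy. -/
theorem entropySum_inf_add_le {r s v : Setoid Ω} (hr : r ≤ v) (hs : s ≤ v) :
    (r ⊓ s).entropySum + v.entropySum ≤ r.entropySum + s.entropySum := by
  classical
  set u := r ⊓ s with hu
  -- By `log t ≤ t - 1`, submodularity reduces to this bound. The products count pairs `(a, b)`; for
  -- a fixed pair, the `ω` with `r a ω` and `s b ω` form a single class of `u` or none.
  have key : ∑ ω, ((r.classCard ω : ℝ) * s.classCard ω) / (u.classCard ω * v.classCard ω)
      ≤ Fintype.card Ω := by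
    have e1 : ∀ ω, ((r.classCard ω : ℝ) * s.classCard ω) / (u.classCard ω * v.classCard ω)
        = ∑ a, ∑ b, if r a ω ∧ s b ω then 1 / ((u.classCard ω : ℝ) * v.classCard ω) else 0 := by
      intro ω
      have ea : (r.classCard ω : ℝ) = ∑ a, if r a ω then (1 : ℝ) else 0 := by
        simp [classCard]
      have eb : (s.classCard ω : ℝ) = ∑ b, if s b ω then (1 : ℝ) else 0 := by
        simp [classCard]
      rw [ea, eb, Finset.sum_mul_sum, Finset.sum_div]
      refine Finset.sum_congr rfl fun a _ => ?_
      rw [Finset.sum_div]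
      refine Finset.sum_congr rfl fun b _ => ?_
      by_cases h1 : r a ω <;> by_cases h2 : s b ω <;> simp [h1, h2]
    have e2 : ∀ a b, (∑ ω, if r a ω ∧ s b ω then
        1 / ((u.classCard ω : ℝ) * v.classCard ω) else 0) ≤
        if v b a then 1 / (v.classCard a : ℝ) else 0 := by
      intro a b
      by_cases hex : ∃ g, r a g ∧ s b g
      · obtain ⟨g, ha, hb⟩ := hex
        have hv : v b a := v.trans (hs hb) (v.symm (hr ha))
        rw [if_pos hv]
        have hcl : ∀ ω, (r a ω ∧ s b ω) ↔ u ω g := fun ω =>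
          ⟨fun h => ⟨r.trans (r.symm h.1) ha, s.trans (s.symm h.2) hb⟩,
            fun h => ⟨r.trans ha (r.symm h.1), s.trans hb (s.symm h.2)⟩⟩
        have : ∀ ω, (if r a ω ∧ s b ω then
            1 / ((u.classCard ω : ℝ) * v.classCard ω) else 0) =
            if u ω g then 1 / ((u.classCard g : ℝ) * v.classCard a) else 0 := by
          intro ω
          by_cases h : u ω g
          · have h' := (hcl ω).2 h
            rw [if_pos h', if_pos h, classCard_congr u h, classCard_congr v (hr h'.1)]
          · rw [if_neg h, if_neg (fun h' => h ((hcl ω).1 h'))]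
        rw [Finset.sum_congr rfl fun ω _ => this ω, ← Finset.sum_filter, Finset.sum_const,
          nsmul_eq_mul]
        change (u.classCard g : ℝ) * _ ≤ _
        have h1 := u.classCard_cast_pos g
        have h2 := v.classCard_cast_pos a
        apply le_of_eq
        field_simp
      · rw [Finset.sum_eq_zero]
        · split_ifs <;> positivity
        · intro ω _
          exact if_neg fun h => hex ⟨ω, h⟩
    calc _ = ∑ a, ∑ b, ∑ ω, if r a ω ∧ s b ω then
          1 / ((u.classCard ω : ℝ) * v.classCard ω) else 0 := by
          rw [Finset.sum_congr rfl fun ω _ => e1 ω, Finset.sum_comm]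
          exact Finset.sum_congr rfl fun a _ => Finset.sum_comm
      _ ≤ ∑ a, ∑ b, if v b a then 1 / (v.classCard a : ℝ) else 0 :=
          Finset.sum_le_sum fun a _ => Finset.sum_le_sum fun b _ => e2 a b
      _ = ∑ a : Ω, (1 : ℝ) := by
          refine Finset.sum_congr rfl fun a _ => ?_
          rw [← Finset.sum_filter, Finset.sum_const, nsmul_eq_mul]
          change (v.classCard a : ℝ) * _ = 1
          have h2 := v.classCard_cast_pos a
          field_simp
      _ = Fintype.card Ω := by simp
  have hsum : u.entropySum + v.entropySum - (r.entropySum + s.entropySum) ≤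
      ∑ ω, (((r.classCard ω : ℝ) * s.classCard ω) / (u.classCard ω * v.classCard ω) - 1) := by
    unfold entropySum
    rw [← Finset.sum_add_distrib, ← Finset.sum_add_distrib, ← Finset.sum_sub_distrib]
    refine Finset.sum_le_sum fun ω _ => ?_
    have h1 := r.classCard_cast_pos ω
    have h2 := s.classCard_cast_pos ω
    have h3 := u.classCard_cast_pos ω
    have h4 := v.classCard_cast_pos ω
    have hc : (0 : ℝ) < Fintype.card Ω := Nat.cast_pos.2 (Fintype.card_pos_iff.2 ⟨ω⟩)
    refine le_trans (le_of_eq ?_) (Real.log_le_sub_one_of_pos (by positivity))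
    rw [Real.log_div hc.ne' h1.ne', Real.log_div hc.ne' h2.ne', Real.log_div hc.ne' h3.ne',
      Real.log_div hc.ne' h4.ne', Real.log_div (by positivity) (by positivity),
      Real.log_mul h1.ne' h2.ne', Real.log_mul h3.ne' h4.ne']
    ring
  rw [Finset.sum_sub_distrib] at hsum
  simp only [Finset.sum_const, Finset.card_univ, nsmul_eq_mul, mul_one] at hsum
  linarith

theorem entropySum_inf_le (r s : Setoid Ω) :
    (r ⊓ s).entropySum ≤ r.entropySum + s.entropySum := by
  have := entropySum_inf_add_le (le_top : r ≤ ⊤) (le_top : s ≤ ⊤)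
  rwa [entropySum_top, add_zero] at this

theorem entropySum_finset_inf_le {ι : Type*} (S : Finset ι) (x : ι → Setoid Ω) :
    (S.inf x).entropySum ≤ ∑ i ∈ S, (x i).entropySum := by
  classical
  induction S using Finset.induction_on with
  | empty => simp [entropySum_top]
  | insert a s ha ih =>
    rw [Finset.inf_insert, Finset.sum_insert ha]
    exact (entropySum_inf_le _ _).trans (by gcongr)

/-- The entropy of a function is at most the logarithm of the size of its codomain. -/
theorem entropySum_ker_le {V : Type*} [Fintype V] (f : Ω → V) :
    (Setoid.ker f).entropySum ≤ Fintype.card Ω * Real.log (Fintype.card V) := by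
  classical
  -- Each class contributes exactly 1, so the sum counts the values that `f` takes.
  have key : ∑ ω, (1 : ℝ) / (Setoid.ker f).classCard ω ≤ Fintype.card V := by
    rw [← Finset.sum_fiberwise Finset.univ f]
    calc _ ≤ ∑ _v : V, (1 : ℝ) := by
          refine Finset.sum_le_sum fun v _ => ?_
          have : ∀ ω ∈ Finset.univ.filter (fun ω => f ω = v),
              (1 : ℝ) / (Setoid.ker f).classCard ω =
                1 / (Finset.univ.filter (fun ω => f ω = v)).card := by
            intro ω hω
            have hω' : f ω = v := by simpa using hω
            simp [classCard, Setoid.ker_def, hω']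
          rw [Finset.sum_congr rfl this, Finset.sum_const, nsmul_eq_mul, mul_one_div]
          exact div_self_le_one _
      _ = Fintype.card V := by simp
  have hsum : (Setoid.ker f).entropySum - Fintype.card Ω * Real.log (Fintype.card V) ≤
      ∑ ω, ((Fintype.card Ω : ℝ) / Fintype.card V * (1 / (Setoid.ker f).classCard ω) - 1) := by
    have : (Fintype.card Ω : ℝ) * Real.log (Fintype.card V) =
        ∑ _ω : Ω, Real.log (Fintype.card V) := by simp
    unfold entropySum
    rw [this, ← Finset.sum_sub_distrib]
    refine Finset.sum_le_sum fun ω _ => ?_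
    have h1 := (Setoid.ker f).classCard_cast_pos ω
    have hc : (0 : ℝ) < Fintype.card Ω := Nat.cast_pos.2 (Fintype.card_pos_iff.2 ⟨ω⟩)
    have hv : (0 : ℝ) < Fintype.card V := Nat.cast_pos.2 (Fintype.card_pos_iff.2 ⟨f ω⟩)
    rw [← Real.log_div (by positivity) hv.ne']
    refine le_trans (le_of_eq ?_) (Real.log_le_sub_one_of_pos (by positivity))
    congr 1
    field_simp
  rw [Finset.sum_sub_distrib, ← Finset.mul_sum] at hsum
  simp only [Finset.sum_const, Finset.card_univ, nsmul_eq_mul, mul_one] at hsum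
  have : (Fintype.card Ω : ℝ) / Fintype.card V * ∑ ω, (1 : ℝ) / (Setoid.ker f).classCard ω ≤
      Fintype.card Ω := by
    calc _ ≤ (Fintype.card Ω : ℝ) / Fintype.card V * Fintype.card V := by gcongr
      _ ≤ Fintype.card Ω := by
        rcases eq_or_ne (Fintype.card V : ℝ) 0 with h | h
        · simp [h]
        · rw [div_mul_cancel₀ _ h]
  linarith

end Setoid

end PartitionEntropy

/-! ### Summation by parts -/

section SummationByParts

theorem neg_mul_le_sum_range_mul {a d : ℕ → ℝ} {δ : ℝ} (ha : Antitone a) (h0 : ∀ i, 0 ≤ a i)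
    (hd : ∀ n, -δ ≤ ∑ i ∈ Finset.range n, d i) (n : ℕ) :
    -(a 0 * δ) ≤ ∑ i ∈ Finset.range n, a i * d i := by
  have hd' : ∀ n, 0 ≤ ∑ i ∈ Finset.range n, d i + δ := fun n => by linarith [hd n]
  -- Shifting the partial sums by `δ` makes them non-negative, so lowering the weight from `a n` to
  -- `a (n + 1)` preserves the inequality.
  have key : ∀ n, a n * (∑ i ∈ Finset.range n, d i + δ) ≤
      ∑ i ∈ Finset.range n, a i * d i + a 0 * δ := by
    intro n
    induction n with
    | zero => simp
    | succ n ih =>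
      calc _ ≤ a n * (∑ i ∈ Finset.range (n + 1), d i + δ) :=
            mul_le_mul_of_nonneg_right (ha n.le_succ) (hd' _)
        _ = a n * (∑ i ∈ Finset.range n, d i + δ) + a n * d n := by
            rw [Finset.sum_range_succ]; ring
        _ ≤ _ := by rw [Finset.sum_range_succ]; linarith
  linarith [(mul_nonneg (h0 n) (hd' n)).trans (key n)]

/-- If all sums of `g` over initial segments `{s ≤ l}` are at least `-δ`, then the sum weighted
by a non-negative antitone function of `s` is at least `-δ` times the largest weight. -/
theorem neg_mul_le_sum_rank_mul {ι : Type*} (S : Finset ι) (s : ι → ℕ) {a : ℕ → ℝ} {g : ι → ℝ}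
    {δ : ℝ} (hδ : 0 ≤ δ) (ha : Antitone a) (h0 : ∀ i, 0 ≤ a i)
    (hg : ∀ l, -δ ≤ ∑ i ∈ S.filter (fun i => s i ≤ l), g i) :
    -(a 0 * δ) ≤ ∑ i ∈ S, a (s i) * g i := by
  set N := S.sup s + 1
  have hN : ∀ i ∈ S, s i ∈ Finset.range N := fun i hi =>
    Finset.mem_range.2 (Nat.lt_succ_of_le (Finset.le_sup hi))
  have h1 : ∑ i ∈ S, a (s i) * g i =
      ∑ l ∈ Finset.range N, a l * ∑ i ∈ S.filter (fun i => s i = l), g i := by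
    rw [← Finset.sum_fiberwise_of_maps_to hN]
    refine Finset.sum_congr rfl fun l _ => ?_
    rw [Finset.mul_sum]
    refine Finset.sum_congr rfl fun i hi => ?_
    rw [(Finset.mem_filter.1 hi).2]
  rw [h1]
  refine neg_mul_le_sum_range_mul ha h0 (fun n => ?_) N
  rcases n with _ | n
  · simpa using hδ
  · have := hg n
    rw [← Finset.sum_fiberwise_of_maps_to (t := Finset.range (n + 1)) (g := s)
      (fun i hi => by simp at hi ⊢; omega)] at this
    convert this using 2 with l hl
    rw [Finset.filter_filter]
    refine Finset.sum_congr (Finset.filter_congr fun i _ => ?_) fun _ _ => rfl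
    have := Finset.mem_range.1 hl
    omega

end SummationByParts

/-! ### Chain-rule increments of entropy -/

section Increments

variable {Ω ι : Type*} [Fintype Ω] [Fintype ι]

/-- The entropy that `z a` adds to the `z b` with `ρ b < ρ a`. -/
noncomputable def entropyIncrement (ρ : ι → ℕ) (z : ι → Setoid Ω) (a : ι) : ℝ :=
  ((Finset.univ.filter fun b => ρ b ≤ ρ a).inf z).entropySum -
    ((Finset.univ.filter fun b => ρ b < ρ a).inf z).entropySum

theorem filter_rank_le_eq_insert [DecidableEq ι] {ρ : ι → ℕ} (hρ : Function.Injective ρ) (a : ι) :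
    (Finset.univ.filter fun b => ρ b ≤ ρ a) =
      insert a (Finset.univ.filter fun b => ρ b < ρ a) := by
  ext b
  simp only [Finset.mem_filter, Finset.mem_univ, true_and, Finset.mem_insert]
  rw [le_iff_eq_or_lt, hρ.eq_iff]

/-- Conditioning on less leaves more entropy: adding the elements of `S` in order of rank, each
joins a subset of its predecessors, so by submodularity it adds at least its increment. -/
theorem entropySum_add_sum_increment_le [DecidableEq ι] {ρ : ι → ℕ} (hρ : Function.Injective ρ)
    (z : ι → Setoid Ω) (T S : Finset ι) (h : ∀ t ∈ T, ∀ a ∈ S, ρ t < ρ a) :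
    (T.inf z).entropySum + ∑ a ∈ S, entropyIncrement ρ z a ≤ ((T ∪ S).inf z).entropySum := by
  induction S using Finset.induction_on_max_value ρ with
  | empty => simp
  | insert a s has hmax ih =>
    have ih := ih fun t ht b hb => h t ht b (Finset.mem_insert_of_mem hb)
    set P := Finset.univ.filter fun b => ρ b < ρ a with hP
    have hsub : T ∪ s ⊆ P := by
      intro b hb
      rw [hP, Finset.mem_filter]
      refine ⟨Finset.mem_univ _, ?_⟩
      rcases Finset.mem_union.1 hb with hb | hb
      · exact h b hb a (Finset.mem_insert_self _ _)
      · exact lt_of_le_of_ne (hmax b hb) fun e => has (hρ e ▸ hb)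
    have hle : P.inf z ≤ (T ∪ s).inf z := Finset.inf_mono hsub
    have hins : (T ∪ insert a s).inf z ≤ (T ∪ s).inf z :=
      Finset.inf_mono (Finset.union_subset_union_right (Finset.subset_insert _ _))
    have hsm := Setoid.entropySum_inf_add_le hle hins
    have heq : P.inf z ⊓ (T ∪ insert a s).inf z =
        (Finset.univ.filter fun b => ρ b ≤ ρ a).inf z := by
      rw [← Finset.inf_union]
      congr 1
      rw [filter_rank_le_eq_insert hρ, ← hP, Finset.union_insert, Finset.union_insert,
        Finset.union_eq_left.2 hsub]
    rw [heq] at hsm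
    rw [Finset.sum_insert has, entropyIncrement, ← hP]
    linarith

/-- On an initial segment the increments telescope, which is the chain rule; only this direction is
needed. -/
theorem entropySum_le_sum_increment {ρ : ι → ℕ} (hρ : Function.Injective ρ)
    (z : ι → Setoid Ω) (S : Finset ι) (h : ∀ a ∈ S, ∀ b, ρ b ≤ ρ a → b ∈ S) :
    (S.inf z).entropySum ≤ ∑ a ∈ S, entropyIncrement ρ z a := by
  classical
  induction S using Finset.induction_on_max_value ρ with
  | empty => simp [Setoid.entropySum_top]
  | insert a s has hmax ih =>
    have hs : s = Finset.univ.filter fun b => ρ b < ρ a := by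
      ext b
      simp only [Finset.mem_filter, Finset.mem_univ, true_and]
      refine ⟨fun hb => lt_of_le_of_ne (hmax b hb) fun e => has (hρ e ▸ hb), fun hb => ?_⟩
      refine Finset.mem_of_mem_insert_of_ne (h a (Finset.mem_insert_self _ _) b hb.le) ?_
      rintro rfl
      exact lt_irrefl _ hb
    have ih := ih fun c hc b hb => by
      rw [hs, Finset.mem_filter] at hc ⊢
      exact ⟨Finset.mem_univ _, hb.trans_lt hc.2⟩
    rw [Finset.sum_insert has, entropyIncrement, filter_rank_le_eq_insert hρ, ← hs]
    linarith

end Increments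

/-! ### The converse in terms of entropies -/

/-- The subsets of `Fin K` can be enumerated by decreasing size. -/
theorem exists_rank_card_decreasing (K : ℕ) : ∃ ρ : Finset (Fin K) → ℕ,
    Function.Injective ρ ∧ ∀ A B, B.card < A.card → ρ A < ρ B := by
  classical
  -- Two-digit numbers in base `N`: the leading digit is `K - A.card`, and the enumeration `e`
  -- breaks ties.
  set N := Fintype.card (Finset (Fin K))
  let e := Fintype.equivFin (Finset (Fin K))
  have hlt : ∀ A B : Finset (Fin K), B.card < A.card →
      (K - A.card) * N + e A < (K - B.card) * N + e B := by
    intro A B h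
    have hA := card_finset_fin_le A
    have he : (e A : ℕ) < N := (e A).2
    calc (K - A.card) * N + e A < (K - A.card) * N + N := by omega
      _ = (K - A.card + 1) * N := by ring
      _ ≤ (K - B.card) * N := Nat.mul_le_mul_right _ (by omega)
      _ ≤ _ := Nat.le_add_right _ _
  refine ⟨fun A => (K - A.card) * N + e A, fun A B h => ?_, hlt⟩
  rcases lt_trichotomy A.card B.card with hc | hc | hc
  · exact absurd h (hlt B A hc).ne'
  · simp only [hc] at h
    exact e.injective (Fin.ext (by omega))
  · exact absurd h (hlt A B hc).ne

/-- If the symbols `x B`, `B ∋ k`, determine the messages `w A`, `A ∋ k`, then the message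
entropies are bounded by the symbol entropies in every weighting `μ` by levels such that `μ i` is
non-decreasing and `μ i / i` is non-increasing. -/
theorem weighted_message_entropy_le {Ω : Type*} [Fintype Ω] {K : ℕ}
    (x w : Finset (Fin K) → Setoid Ω)
    (hdec : ∀ k A, k ∈ A → (Finset.univ.filter fun B => k ∈ B).inf x ≤ w A)
    {μ : ℕ → ℝ} (h0 : μ 0 = 0) (hmono : Monotone μ)
    (hstar : ∀ i : ℕ, (i : ℝ) * μ (i + 1) ≤ ((i : ℝ) + 1) * μ i)
    (ℓ : Finset (Fin K) → ℝ) {δ : ℝ} (hδ : 0 ≤ δ)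
    (hw : ∀ T : Finset (Finset (Fin K)), ∑ A ∈ T, ℓ A - δ ≤ (T.inf w).entropySum) :
    ∑ A, μ A.card * ℓ A - μ K * δ ≤ ∑ A, μ A.card * (x A).entropySum := by
  classical
  obtain ⟨ρ, hρ, hcard⟩ := exists_rank_card_decreasing K
  have hμ : ∀ i, 0 ≤ μ i := fun i => h0 ▸ hmono (Nat.zero_le i)
  set z : Finset (Fin K) → Setoid Ω := fun A => x A ⊓ w A with hz
  set D := entropyIncrement ρ z with hD
  have upper : ∑ A, μ A.card * D A ≤ ∑ A, μ A.card * (x A).entropySum := by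
    -- This is `μ i / i` shifted by one level; the shift is harmless because a set containing `k`
    -- has size at least 1.
    have hν : Antitone fun i : ℕ => μ (i + 1) / ((i : ℝ) + 1) := by
      refine antitone_nat_of_succ_le fun i => ?_
      have := hstar (i + 1)
      push_cast at this ⊢
      rw [div_le_div_iff₀ (by positivity) (by positivity)]
      linarith
    have hk : ∀ k : Fin K, 0 ≤ ∑ A ∈ Finset.univ.filter (fun A : Finset (Fin K) => k ∈ A),
        μ (A.card - 1 + 1) / (((A.card - 1 : ℕ) : ℝ) + 1) * ((x A).entropySum - D A) := by
      intro k
      have := neg_mul_le_sum_rank_mul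
        (Finset.univ.filter (fun A : Finset (Fin K) => k ∈ A)) (fun A => A.card - 1)
        (g := fun A => (x A).entropySum - D A) le_rfl hν
        (fun i => div_nonneg (hμ _) (by positivity)) (fun l => ?_)
      · simpa using this
      · rw [neg_zero, Finset.sum_sub_distrib, sub_nonneg]
        set S := (Finset.univ.filter (fun A : Finset (Fin K) => k ∈ A)).filter
          (fun A => A.card - 1 ≤ l) with hS
        set T := Finset.univ.filter (fun A : Finset (Fin K) => l < A.card - 1) with hT
        have h1 := entropySum_add_sum_increment_le hρ z T S fun t ht a ha => hcard t a (by
          simp only [hS, hT, Finset.mem_filter] at ht ha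
          omega)
        -- Every symbol that receiver `k` sees belongs to `S` or `T`, so the symbols of `S` together
        -- with the pairs of `T` yield the messages of `S`.
        have hle : S.inf x ⊓ T.inf z ≤ (T ∪ S).inf z := by
          rw [Finset.inf_union]
          refine le_inf inf_le_right (Finset.le_inf fun A hA => le_inf
            (inf_le_left.trans (Finset.inf_le hA)) ?_)
          have hkA : k ∈ A := by
            simp only [hS, Finset.mem_filter] at hA
            exact hA.1.2
          refine le_trans (Finset.le_inf fun B hB => ?_) (hdec k A hkA)
          by_cases hl : B.card - 1 ≤ l
          · exact inf_le_left.trans (Finset.inf_le (Finset.mem_filter.2 ⟨hB, hl⟩))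
          · have hBT : B ∈ T := Finset.mem_filter.2 ⟨Finset.mem_univ _, not_le.1 hl⟩
            have hzx : T.inf z ≤ x B := (Finset.inf_le hBT).trans inf_le_left
            exact inf_le_right.trans hzx
        have h2 := Setoid.entropySum_anti hle
        have h3 := Setoid.entropySum_inf_le (S.inf x) (T.inf z)
        have h4 := Setoid.entropySum_finset_inf_le S x
        linarith
    have hsum := Finset.sum_nonneg fun k (_ : k ∈ (Finset.univ : Finset (Fin K))) => hk k
    -- Each `A` is counted by its `A.card` receivers, which cancels the denominator; the empty set
    -- drops out since `μ 0 = 0`.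
    have hcomm : ∑ k : Fin K, ∑ A ∈ Finset.univ.filter (fun A : Finset (Fin K) => k ∈ A),
        μ (A.card - 1 + 1) / (((A.card - 1 : ℕ) : ℝ) + 1) * ((x A).entropySum - D A) =
        ∑ A : Finset (Fin K), μ A.card * ((x A).entropySum - D A) := by
      simp only [Finset.sum_filter]
      rw [Finset.sum_comm]
      refine Finset.sum_congr rfl fun A _ => ?_
      rw [← Finset.sum_filter, Finset.filter_mem_eq_inter, Finset.univ_inter, Finset.sum_const,
        nsmul_eq_mul]
      rcases Nat.eq_zero_or_pos A.card with hA | hA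
      · simp [hA, h0]
      · obtain ⟨c, hc⟩ := Nat.exists_eq_succ_of_ne_zero hA.ne'
        rw [hc]
        simp only [Nat.succ_eq_add_one, Nat.add_sub_cancel]
        push_cast
        field_simp
    rw [hcomm] at hsum
    simp only [mul_sub, Finset.sum_sub_distrib] at hsum
    linarith
  have lower : ∑ A, μ A.card * ℓ A - μ K * δ ≤ ∑ A, μ A.card * D A := by
    -- Ranking by `K - A.card` makes the monotone `μ` antitone, and the largest weight is `μ K`, the
    -- factor of the loss `δ`.
    have := neg_mul_le_sum_rank_mul (Finset.univ : Finset (Finset (Fin K)))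
      (fun A => K - A.card) (a := fun i => μ (K - i)) (g := fun A => D A - ℓ A) hδ
      (fun i j hij => hmono (by omega)) (fun i => hμ _) (fun l => ?_)
    · have hcast : ∀ A : Finset (Fin K), K - (K - A.card) = A.card := fun A => by
        have := card_finset_fin_le A
        omega
      simp only [hcast, mul_sub, Finset.sum_sub_distrib, Nat.sub_zero] at this
      linarith
    · set S := Finset.univ.filter (fun A : Finset (Fin K) => K - A.card ≤ l) with hS
      have h1 := entropySum_le_sum_increment hρ z S fun A hA B hB => by
        simp only [hS, Finset.mem_filter, Finset.mem_univ, true_and] at hA ⊢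
        by_contra hcon
        have := hcard A B (by omega)
        omega
      have h2 : S.inf z ≤ S.inf w := Finset.inf_mono_fun fun A _ => inf_le_right
      have h3 := Setoid.entropySum_anti h2
      have h4 := hw S
      rw [Finset.sum_sub_distrib]
      linarith
  exact lower.trans upper

/-! ### From codes to the weighted rate bound -/

/-- All receivers decode all their messages correctly when the message tuple `w` is sent over the
deterministic channel. -/
def SymmetricBroadcastCode.DecodesCorrectly {K : ℕ} {q : Fin K → ℕ} {n : ℕ} {R : Fin K → ℝ}
    (c : SymmetricBroadcastCode K (DetInput q) (DetOutput q) n R)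
    (w : (A : Finset (Fin K)) → MessageSet n R A) : Prop :=
  ∀ (k : Fin K) (A : {A : Finset (Fin K) // k ∈ A}),
    c.dec k (fun t B => c.enc w t B.1) A = w A.1

theorem messageSet_pos {K : ℕ} (n : ℕ) (R : Fin K → ℝ) (A : Finset (Fin K)) :
    0 < Fintype.card (MessageSet n R A) := by
  rw [Fintype.card_fin, Nat.ceil_pos]
  positivity

instance {K : ℕ} (n : ℕ) (R : Fin K → ℝ) (A : Finset (Fin K)) : Nonempty (MessageSet n R A) :=
  Fintype.card_pos_iff.1 (messageSet_pos n R A)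

-- Since the channel is deterministic, each message tuple fails with probability 0 or 1, and the
-- error probability is the fraction of failing tuples.
open Classical in
theorem card_decodesCorrectly {K : ℕ} {q : Fin K → ℕ} {n : ℕ} {R : Fin K → ℝ}
    (c : SymmetricBroadcastCode K (DetInput q) (DetOutput q) n R) :
    (Fintype.card {w // c.DecodesCorrectly w} : ℝ) =
      (1 - errorProb (deterministicChannel q) c) *
        Fintype.card ((A : Finset (Fin K)) → MessageSet n R A) := by
  have hterm : ∀ w, ((((deterministicChannel q).law n (c.enc w)).toOuterMeasure
        {y | ∃ (k : Fin K) (A : {A : Finset (Fin K) // k ∈ A}),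
          c.dec k (y k) A ≠ w A.1}).toReal) = if ¬ c.DecodesCorrectly w then 1 else 0 := by
    intro w
    simp only [deterministicChannel, PMF.toOuterMeasure_pure_apply, Set.mem_ofPred_eq]
    by_cases h : c.DecodesCorrectly w
    · rw [if_neg, if_neg (not_not.2 h)]
      · simp
      · rintro ⟨k, A, hA⟩
        exact hA (h k A)
    · rw [if_pos, if_pos h]
      · simp
      · simpa [SymmetricBroadcastCode.DecodesCorrectly] using h
  have hM : (0 : ℝ) < Fintype.card ((A : Finset (Fin K)) → MessageSet n R A) :=
    Nat.cast_pos.2 Fintype.card_pos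
  have hcompl := Finset.card_filter_add_card_filter_not
    (s := (Finset.univ : Finset ((A : Finset (Fin K)) → MessageSet n R A))) c.DecodesCorrectly
  rw [Finset.card_univ] at hcompl
  rw [errorProb, Finset.sum_congr rfl fun w _ => hterm w, Finset.sum_boole, Fintype.card_subtype,
    sub_mul, one_mul, div_mul_cancel₀ _ hM.ne', ← hcompl]
  push_cast
  ring

/-- Restricting to the correctly decoded tuples makes decoding exact, so Fano's inequality is not
needed. The price is that the messages are only nearly independent, with loss `-log (1 - ε)`. -/
theorem weighted_code_rate_le {K : ℕ} {q : Fin K → ℕ} {n : ℕ} {R : Fin K → ℝ}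
    (c : SymmetricBroadcastCode K (DetInput q) (DetOutput q) n R)
    (he : errorProb (deterministicChannel q) c < 1)
    {μ : ℕ → ℝ} (h0 : μ 0 = 0) (hmono : Monotone μ)
    (hstar : ∀ i : ℕ, (i : ℝ) * μ (i + 1) ≤ ((i : ℝ) + 1) * μ i) :
    ∑ A : Finset (Fin K), μ A.card * Real.log (Fintype.card (MessageSet n R A)) +
        μ K * Real.log (1 - errorProb (deterministicChannel q) c) ≤
      ∑ A : Finset (Fin K), μ A.card * (n * Real.log (byLevel 1 q A : ℕ)) := by
  classical
  set ε := errorProb (deterministicChannel q) c with hε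
  let Ω := {w // c.DecodesCorrectly w}
  let x : Finset (Fin K) → Setoid Ω := fun A => Setoid.ker fun w t => c.enc w.1 t A
  let w : Finset (Fin K) → Setoid Ω := fun A => Setoid.ker fun w => w.1 A
  have hμ : ∀ i, 0 ≤ μ i := fun i => h0 ▸ hmono (Nat.zero_le i)
  have hM : (0 : ℝ) < Fintype.card ((A : Finset (Fin K)) → MessageSet n R A) :=
    Nat.cast_pos.2 Fintype.card_pos
  have hcard : (Fintype.card Ω : ℝ) = (1 - ε) *
      Fintype.card ((A : Finset (Fin K)) → MessageSet n R A) := card_decodesCorrectly c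
  have hpos : (0 : ℝ) < Fintype.card Ω := hcard ▸ mul_pos (by linarith) hM
  have hε0 : 0 ≤ ε := by
    have : (Fintype.card Ω : ℝ) ≤ Fintype.card ((A : Finset (Fin K)) → MessageSet n R A) :=
      Nat.cast_le.2 (Fintype.card_subtype_le _)
    rw [hcard] at this
    have := le_of_mul_le_mul_right (this.trans_eq (one_mul _).symm) hM
    linarith
  have hlog : Real.log (Fintype.card Ω) = Real.log (1 - ε) +
      ∑ A, Real.log (Fintype.card (MessageSet n R A)) := by
    rw [hcard, Real.log_mul (by linarith) hM.ne', Fintype.card_pi, Nat.cast_prod,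
      Real.log_prod fun A _ => Nat.cast_ne_zero.2 (messageSet_pos n R A).ne']
  have hdec : ∀ k A, k ∈ A → (Finset.univ.filter fun B => k ∈ B).inf x ≤ w A := by
    intro k A hkA a b hab
    have hB : ∀ B, k ∈ B → x B a b := fun B hB =>
      (Finset.inf_le (f := x) (Finset.mem_filter.2 ⟨Finset.mem_univ B, hB⟩) :
        (Finset.univ.filter fun B => k ∈ B).inf x ≤ x B) hab
    have hy : (fun t (B : {B : Finset (Fin K) // k ∈ B}) => c.enc a.1 t B.1) =
        fun t (B : {B : Finset (Fin K) // k ∈ B}) => c.enc b.1 t B.1 := by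
      funext t B
      exact congrFun (hB B.1 B.2) t
    change a.1 A = b.1 A
    rw [← a.2 k ⟨A, hkA⟩, ← b.2 k ⟨A, hkA⟩, hy]
  -- The full tuple has entropy `log |Ω|`; subtracting at most the log-cardinalities of the messages
  -- outside `T` leaves this bound.
  have hw : ∀ T : Finset (Finset (Fin K)),
      ∑ A ∈ T, Fintype.card Ω * Real.log (Fintype.card (MessageSet n R A)) -
        -(Fintype.card Ω * Real.log (1 - ε)) ≤ (T.inf w).entropySum := by
    intro T
    have hbot : T.inf w ⊓ Tᶜ.inf w ≤ ⊥ := by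
      rw [← Finset.inf_union, Finset.union_compl]
      intro a b hab
      have : ∀ A, w A a b := fun A =>
        (Finset.inf_le (f := w) (Finset.mem_univ A) : Finset.univ.inf w ≤ w A) hab
      exact Subtype.ext (funext fun A => this A)
    have h1 := Setoid.entropySum_anti hbot
    rw [Setoid.entropySum_bot, hlog] at h1
    have h2 := Setoid.entropySum_inf_le (T.inf w) (Tᶜ.inf w)
    have h3 := Setoid.entropySum_finset_inf_le Tᶜ w
    have h4 : ∑ A ∈ Tᶜ, (w A).entropySum ≤
        ∑ A ∈ Tᶜ, Fintype.card Ω * Real.log (Fintype.card (MessageSet n R A)) :=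
      Finset.sum_le_sum fun A _ => Setoid.entropySum_ker_le _
    have h5 := Finset.sum_add_sum_compl T
      fun A => (Fintype.card Ω : ℝ) * Real.log (Fintype.card (MessageSet n R A))
    rw [← Finset.mul_sum Finset.univ] at h5
    rw [mul_add] at h1
    linarith
  have hδ : 0 ≤ -(Fintype.card Ω * Real.log (1 - ε)) := by
    rw [← mul_neg]
    exact mul_nonneg hpos.le (neg_nonneg.2 (Real.log_nonpos (by linarith) (by linarith)))
  have hmain := weighted_message_entropy_le x w hdec h0 hmono hstar _ hδ hw
  have hx : ∑ A, μ A.card * (x A).entropySum ≤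
      ∑ A : Finset (Fin K), μ A.card * (Fintype.card Ω * (n * Real.log (byLevel 1 q A : ℕ))) := by
    refine Finset.sum_le_sum fun A _ => mul_le_mul_of_nonneg_left ?_ (hμ _)
    refine (Setoid.entropySum_ker_le _).trans_eq ?_
    rw [Fintype.card_fun, Fintype.card_fin, Fintype.card_fin, Nat.cast_pow, Real.log_pow]
  have hfac : ∀ f : Finset (Fin K) → ℝ, ∑ A : Finset (Fin K), μ A.card * (Fintype.card Ω * f A) =
      Fintype.card Ω * ∑ A : Finset (Fin K), μ A.card * f A := fun f => by
    rw [Finset.mul_sum]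
    exact Finset.sum_congr rfl fun A _ => by ring
  have hfin := hmain.trans hx
  rw [hfac, hfac] at hfin
  refine le_of_mul_le_mul_left ?_ hpos
  rw [mul_add]
  linarith

theorem sum_card_mul_byLevel {K : ℕ} {μ : ℕ → ℝ} (h0 : μ 0 = 0) (R : Fin K → ℝ) :
    ∑ A : Finset (Fin K), μ A.card * byLevel 0 R A =
      ∑ i : Fin K, (K.choose (i + 1) : ℝ) * μ (i + 1) * R i := by
  classical
  let f : ℕ → ℝ := fun j => if h : j - 1 < K then μ j * R ⟨j - 1, h⟩ else 0
  have h1 : ∀ A : Finset (Fin K), μ A.card * byLevel 0 R A = f A.card := by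
    intro A
    have hA := card_finset_fin_le A
    rcases A.eq_empty_or_nonempty with rfl | hne
    · simp [f, h0]
    · have := hne.card_pos
      simp only [f, byLevel, dif_pos hne, dif_pos (show A.card - 1 < K by omega)]
  have h2 := Finset.sum_powerset_apply_card f (x := (Finset.univ : Finset (Fin K)))
  rw [Finset.powerset_univ, Finset.card_univ, Fintype.card_fin, Finset.sum_range_succ'] at h2
  rw [Finset.sum_congr rfl fun A _ => h1 A, h2, ← Fin.sum_univ_eq_sum_range
    (fun i => K.choose (i + 1) • f (i + 1))]
  have hf0 : f 0 = 0 := by simp [f, h0]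
  rw [hf0, smul_zero, add_zero]
  refine Finset.sum_congr rfl fun i _ => ?_
  simp [f, mul_assoc]

theorem log_byLevel {K : ℕ} {Rstar : Fin K → ℝ} {q : Fin K → ℕ}
    (hq : ∀ i, (q i : ℝ) = (2 : ℝ) ^ Rstar i) (A : Finset (Fin K)) :
    Real.log (byLevel 1 q A : ℕ) = byLevel 0 Rstar A * Real.log 2 := by
  unfold byLevel
  split_ifs with h
  · rw [hq, Real.log_rpow (by norm_num)]
  · simp

/-- The converse bound: every capacity-region rate vector satisfies the weighted rate bound for
every weighting `μ` by levels such that `μ i` is non-decreasing and `μ i / i` is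
non-increasing. -/
theorem weighted_rate_le_of_mem_capacityRegion {K : ℕ} {Rstar : Fin K → ℝ} {q : Fin K → ℕ}
    (hq : ∀ i, (q i : ℝ) = (2 : ℝ) ^ Rstar i)
    {μ : ℕ → ℝ} (h0 : μ 0 = 0) (hmono : Monotone μ)
    (hstar : ∀ i : ℕ, (i : ℝ) * μ (i + 1) ≤ ((i : ℝ) + 1) * μ i)
    {R : Fin K → ℝ} (hR : R ∈ capacityRegion (deterministicChannel q)) :
    ∑ i : Fin K, (K.choose (i + 1) : ℝ) * μ (i + 1) * R i ≤
      ∑ i : Fin K, (K.choose (i + 1) : ℝ) * μ (i + 1) * Rstar i := by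
  have hμ : ∀ i, 0 ≤ μ i := fun i => h0 ▸ hmono (Nat.zero_le i)
  have hclosed : IsClosed {R : Fin K → ℝ | ∑ i : Fin K, (K.choose (i + 1) : ℝ) * μ (i + 1) * R i ≤
      ∑ i : Fin K, (K.choose (i + 1) : ℝ) * μ (i + 1) * Rstar i} :=
    isClosed_le (by fun_prop) continuous_const
  refine closure_minimal ?_ hclosed hR
  rintro R ⟨-, c, hc⟩
  rw [Set.mem_ofPred_eq, ← sum_card_mul_byLevel h0, ← sum_card_mul_byLevel h0]
  set a := ∑ A : Finset (Fin K), μ A.card * byLevel 0 R A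
  set b := ∑ A : Finset (Fin K), μ A.card * byLevel 0 Rstar A
  -- After division by `n` the loss from restricting to good tuples vanishes.
  have hlim : Filter.Tendsto (fun n : ℕ => a * Real.log 2 +
      μ K * Real.log (1 - errorProb (deterministicChannel q) (c n)) / n) Filter.atTop
      (nhds (a * Real.log 2 + 0)) := by
    refine Filter.Tendsto.const_add _ (Filter.Tendsto.div_atTop (a := μ K * Real.log (1 - 0))
      (Filter.Tendsto.const_mul _ ((hc.const_sub 1).log (by norm_num)))
      tendsto_natCast_atTop_atTop)
  have hev : ∀ᶠ n : ℕ in Filter.atTop, a * Real.log 2 +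
      μ K * Real.log (1 - errorProb (deterministicChannel q) (c n)) / n ≤ b * Real.log 2 := by
    filter_upwards [hc.eventually (gt_mem_nhds one_pos), Filter.eventually_gt_atTop 0]
      with n hn hn0
    have hn0' : (0 : ℝ) < n := Nat.cast_pos.2 hn0
    have h := weighted_code_rate_le (c n) hn h0 hmono hstar
    have hL : n * (a * Real.log 2) ≤
        ∑ A : Finset (Fin K), μ A.card * Real.log (Fintype.card (MessageSet n R A)) := by
      rw [Finset.sum_mul, Finset.mul_sum]
      refine Finset.sum_le_sum fun A _ => ?_
      have : (n : ℝ) * byLevel 0 R A * Real.log 2 ≤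
          Real.log (Fintype.card (MessageSet n R A)) := by
        rw [← Real.log_rpow (by norm_num), Fintype.card_fin]
        exact Real.log_le_log (by positivity) (Nat.le_ceil _)
      calc _ = μ A.card * ((n : ℝ) * byLevel 0 R A * Real.log 2) := by ring
        _ ≤ _ := mul_le_mul_of_nonneg_left this (hμ _)
    have hU : ∑ A : Finset (Fin K), μ A.card * (n * Real.log (byLevel 1 q A : ℕ)) =
        n * (b * Real.log 2) := by
      rw [Finset.sum_mul, Finset.mul_sum]
      refine Finset.sum_congr rfl fun A _ => ?_
      rw [log_byLevel hq]
      ring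
    rw [hU] at h
    refine le_of_mul_le_mul_left ?_ hn0'
    rw [mul_add, mul_div_cancel₀ _ hn0'.ne']
    linarith
  have := le_of_tendsto hlim hev
  rw [add_zero] at this
  exact le_of_mul_le_mul_right this (Real.log_pos (by norm_num))

/-! ### Exchange rates and the linear programme -/

/-- In terms of total rates `K.choose i * R_i` the exchange is uniform: lossless towards smaller
sets, with factor `i / j` towards larger ones. -/
theorem exchangeRate_eq {K i j : ℕ} (hi : 1 ≤ i) (hj : 1 ≤ j) (hiK : i ≤ K) (hjK : j ≤ K) :
    exchangeRate K i j = K.choose i / K.choose j * min 1 ((i : ℝ) / j) := by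
  have hNi : (0 : ℝ) < K.choose i := Nat.cast_pos.2 (Nat.choose_pos hiK)
  have hNj : (0 : ℝ) < K.choose j := Nat.cast_pos.2 (Nat.choose_pos hjK)
  have hi0 : (0 : ℝ) < i := Nat.cast_pos.2 hi
  have hj0 : (0 : ℝ) < j := Nat.cast_pos.2 hj
  unfold exchangeRate
  split_ifs with h1 h2
  · have hc : (0 : ℝ) < (K - i).choose (j - i) := Nat.cast_pos.2 (Nat.choose_pos (by omega))
    have e1 : (K.choose j : ℝ) * j.choose i = K.choose i * (K - i).choose (j - i) := by
      exact_mod_cast Nat.choose_mul (n := K) h1.le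
    have e2 : (j : ℝ) * (j - 1).choose (j - i) = j.choose i * i := by
      obtain ⟨i, rfl⟩ := Nat.exists_eq_add_of_le' hi
      obtain ⟨j, rfl⟩ := Nat.exists_eq_add_of_le' hj
      have h3 : j + 1 - (i + 1) = j - i := by omega
      have h4 := Nat.add_one_mul_choose_eq j i
      rw [h3, Nat.add_sub_cancel, Nat.choose_symm (by omega)]
      exact_mod_cast h4
    have hle : (i : ℝ) / j ≤ 1 := (div_le_one hj0).2 (by exact_mod_cast h1.le)
    rw [min_eq_right hle]
    field_simp
    calc ((j - 1).choose (j - i) : ℝ) * K.choose j * j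
        = K.choose j * (j * (j - 1).choose (j - i)) := by ring
      _ = (K.choose j * j.choose i) * i := by rw [e2]; ring
      _ = _ := by rw [e1]; ring
  · have hc : (0 : ℝ) < i.choose (i - j) := Nat.cast_pos.2 (Nat.choose_pos (by omega))
    have e1 : (K.choose i : ℝ) * i.choose (i - j) = K.choose j * (K - j).choose (i - j) := by
      rw [Nat.choose_symm h2.le]
      exact_mod_cast Nat.choose_mul (n := K) h2.le
    have hle : 1 ≤ (i : ℝ) / j := (one_le_div hj0).2 (by exact_mod_cast h2.le)
    rw [min_eq_left hle, mul_one]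
    field_simp
    linarith
  · obtain rfl : i = j := by omega
    rw [div_self hNi.ne', div_self hi0.ne']
    simp

/-- The value of one unit of total level-`i` rate after the best exchange, when one unit of total
level-`j + 1` rate is worth `a j`. -/
noncomputable def bestExchangeValue {K : ℕ} (a : Fin K → ℝ) (i : ℕ) : ℝ :=
  ⨆ j : Fin K, min 1 ((i : ℝ) / ((j : ℕ) + 1 : ℕ)) * a j

section BestExchangeValue

variable {K : ℕ} {a : Fin K → ℝ}

theorem bestExchangeValue_zero : bestExchangeValue a 0 = 0 := by
  simp [bestExchangeValue]

theorem le_bestExchangeValue (i : ℕ) (j : Fin K) :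
    min 1 ((i : ℝ) / ((j : ℕ) + 1 : ℕ)) * a j ≤ bestExchangeValue a i :=
  le_ciSup (f := fun j : Fin K => min 1 ((i : ℝ) / ((j : ℕ) + 1 : ℕ)) * a j)
    (Set.finite_range _).bddAbove j

theorem bestExchangeValue_mono (ha : ∀ j, 0 ≤ a j) : Monotone (bestExchangeValue a) := by
  intro i i' h
  refine ciSup_mono (Set.finite_range _).bddAbove fun j => ?_
  have := ha j
  gcongr

/-- Each function `min 1 (i / j)` has this property, and it survives non-negative scaling and
maxima. -/
theorem mul_bestExchangeValue_succ_le (ha : ∀ j, 0 ≤ a j) (i : ℕ) :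
    (i : ℝ) * bestExchangeValue a (i + 1) ≤ ((i : ℝ) + 1) * bestExchangeValue a i := by
  rcases isEmpty_or_nonempty (Fin K) with hK | hK
  · simp [bestExchangeValue]
  · rw [bestExchangeValue, Real.mul_iSup_of_nonneg (by positivity)]
    refine ciSup_le fun j => ?_
    refine le_trans ?_ (mul_le_mul_of_nonneg_left (le_bestExchangeValue i j) (by positivity))
    rw [← mul_assoc, ← mul_assoc]
    refine mul_le_mul_of_nonneg_right ?_ (ha j)
    rw [mul_min_of_nonneg _ _ (by positivity), mul_min_of_nonneg _ _ (by positivity)]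
    refine min_le_min (by linarith) (le_of_eq ?_)
    push_cast
    ring

theorem exists_bestExchangeValue_eq [Nonempty (Fin K)] (i : ℕ) :
    ∃ j : Fin K, bestExchangeValue a i = min 1 ((i : ℝ) / ((j : ℕ) + 1 : ℕ)) * a j := by
  obtain ⟨j, hj⟩ := exists_eq_ciSup_of_finite
    (f := fun j : Fin K => min 1 ((i : ℝ) / ((j : ℕ) + 1 : ℕ)) * a j)
  exact ⟨j, hj.symm⟩

end BestExchangeValue

/-- The `v i` are dual prices for the budgets `Rstar i`; spending each whole budget on level `g i`
attains the dual bound. -/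
theorem isGreatest_exchangeRegion {K : ℕ} {Rstar : Fin K → ℝ} (hRstar : ∀ i, 0 ≤ Rstar i)
    {A : Fin K → ℝ} (hA : ∀ i, 0 ≤ A i) {v : Fin K → ℝ} (g : Fin K → Fin K)
    (hv : ∀ i j : Fin K, exchangeRate K (i + 1) (j + 1) * A j ≤ v i)
    (hg : ∀ i : Fin K, exchangeRate K (i + 1) (g i + 1) * A (g i) = v i) :
    IsGreatest ((fun R : Fin K → ℝ => ∑ k, A k * R k) '' exchangeRegion Rstar)
      (∑ i, v i * Rstar i) := by
  have hφ : ∀ i j, 0 ≤ exchangeRate K i j := fun i j => by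
    unfold exchangeRate
    split_ifs <;> positivity
  constructor
  · let r : Fin K → Fin K → ℝ := fun i j => if j = g i then Rstar i else 0
    have hr : ∀ i j, 0 ≤ r i j := fun i j => by
      have := hRstar i
      simp only [r]
      split_ifs <;> simp [this]
    refine ⟨fun j => ∑ i : Fin K, exchangeRate K (i + 1) (j + 1) * r i j,
      ⟨r, hr, fun i => by simp [r], fun j => ⟨?_, le_rfl⟩⟩, ?_⟩
    · exact Finset.sum_nonneg fun i _ => mul_nonneg (hφ _ _) (hr _ _)
    · simp only [Finset.mul_sum]
      rw [Finset.sum_comm]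
      refine Finset.sum_congr rfl fun i _ => ?_
      rw [Finset.sum_eq_single (g i)]
      · simp only [r, if_true]
        rw [← hg i]
        ring
      · intro j _ hj
        simp [r, hj]
      · simp
  · rintro _ ⟨R, ⟨r, hr, hsum, hR⟩, rfl⟩
    calc ∑ j, A j * R j
        ≤ ∑ j, A j * ∑ i : Fin K, exchangeRate K (i + 1) (j + 1) * r i j :=
          Finset.sum_le_sum fun j _ => mul_le_mul_of_nonneg_left (hR j).2 (hA j)
      _ = ∑ i : Fin K, ∑ j : Fin K, exchangeRate K (i + 1) (j + 1) * A j * r i j := by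
          simp only [Finset.mul_sum]
          rw [Finset.sum_comm]
          exact Finset.sum_congr rfl fun i _ => Finset.sum_congr rfl fun j _ => by ring
      _ ≤ ∑ i : Fin K, ∑ j : Fin K, v i * r i j :=
          Finset.sum_le_sum fun i _ => Finset.sum_le_sum fun j _ =>
            mul_le_mul_of_nonneg_right (hv i j) (hr i j)
      _ = ∑ i : Fin K, v i * ∑ j : Fin K, r i j := by simp only [Finset.mul_sum]
      _ ≤ _ := Finset.sum_le_sum fun i _ => mul_le_mul_of_nonneg_left (hsum i)
            ((mul_nonneg (hφ _ _) (hA i)).trans (hv i i))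

/-! ### Existence of the maximum over the capacity region -/

theorem byLevel_zero_zero {K : ℕ} (A : Finset (Fin K)) :
    byLevel (0 : ℝ) (0 : Fin K → ℝ) A = 0 := by
  unfold byLevel
  split_ifs <;> rfl

theorem zero_mem_capacityRegion {K : ℕ} {q : Fin K → ℕ} (hq : ∀ i, 0 < q i) :
    (0 : Fin K → ℝ) ∈ capacityRegion (deterministicChannel q) := by
  have hinput : ∀ A : Finset (Fin K), 0 < byLevel 1 q A := fun A => by
    unfold byLevel
    split_ifs
    · exact hq _
    · exact one_pos
  have hsub : ∀ n (A : Finset (Fin K)), Subsingleton (MessageSet n (0 : Fin K → ℝ) A) :=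
    fun n A => Fintype.card_le_one_iff_subsingleton.1 (by simp [byLevel_zero_zero])
  refine subset_closure ⟨fun _ => le_rfl, fun n =>
    ⟨fun _ _ A => ⟨0, hinput A⟩, fun _ _ _ => Classical.arbitrary _⟩, ?_⟩
  refine (Filter.tendsto_congr fun n => ?_).2 tendsto_const_nhds
  rw [errorProb, Finset.sum_eq_zero fun w _ => ?_, zero_div]
  refine (congrArg ENNReal.toReal ?_).trans ENNReal.toReal_zero
  rw [PMF.toOuterMeasure_apply_eq_zero_iff, Set.disjoint_right]
  rintro y ⟨k, A, hA⟩
  exact (hA ((hsub n A.1).elim _ _)).elim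

theorem isCompact_capacityRegion {K : ℕ} {Rstar : Fin K → ℝ} {q : Fin K → ℕ}
    (hq : ∀ i, (q i : ℝ) = (2 : ℝ) ^ Rstar i) :
    IsCompact (capacityRegion (deterministicChannel q)) := by
  -- An admissible weighting equal to 1 on all positive levels; its converse bounds every
  -- coordinate.
  set μ : ℕ → ℝ := fun i => min 1 (i : ℝ) with hμ
  set M : ℝ := ∑ i : Fin K, (K.choose (i + 1) : ℝ) * μ (i + 1) * Rstar i
  have hmono : Monotone μ := fun i j h => min_le_min le_rfl (Nat.cast_le.2 h)
  have hsucc : ∀ i : ℕ, μ (i + 1) = 1 := fun i => by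
    simp [hμ]
  have hstar : ∀ i : ℕ, (i : ℝ) * μ (i + 1) ≤ ((i : ℝ) + 1) * μ i := fun i => by
    rcases i with _ | i
    · simp [hμ]
    · rw [hsucc, hsucc]
      linarith
  refine (isCompact_Icc (a := (0 : Fin K → ℝ)) (b := fun _ => M)).of_isClosed_subset
    isClosed_closure fun R hR => ?_
  have hnonneg : (0 : Fin K → ℝ) ≤ R :=
    closure_minimal (fun R hR => hR.1) (isClosed_Ici (a := (0 : Fin K → ℝ))) hR
  refine ⟨hnonneg, fun i => ?_⟩
  have hsum := weighted_rate_le_of_mem_capacityRegion hq (by simp [hμ]) hmono hstar hR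
  refine le_trans ?_ hsum
  have hi : (1 : ℝ) ≤ K.choose (i + 1) := by exact_mod_cast Nat.choose_pos i.2
  calc R i ≤ (K.choose (i + 1) : ℝ) * μ (i + 1) * R i := by
        rw [hsucc, mul_one]
        exact le_mul_of_one_le_left (hnonneg i) hi
    _ ≤ _ := Finset.single_le_sum
        (f := fun i : Fin K => (K.choose (i + 1) : ℝ) * μ (i + 1) * R i)
        (fun j _ => mul_nonneg (by rw [hsucc]; positivity) (hnonneg j)) (Finset.mem_univ i)

/-! ### Comparison of the two maxima -/

theorem theorem2 (K : ℕ) (Rstar : Fin K → ℝ) (q : Fin K → ℕ)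
    (hq : ∀ i, (q i : ℝ) = (2 : ℝ) ^ Rstar i)
    (A : Fin K → ℝ) (hA : ∀ i, 0 ≤ A i) :
    ∃ Bstar B : ℝ,
      IsGreatest ((fun R : Fin K → ℝ => ∑ k, A k * R k) '' exchangeRegion Rstar) Bstar ∧
      IsGreatest ((fun R : Fin K → ℝ => ∑ k, A k * R k) ''
        capacityRegion (deterministicChannel q)) B ∧
      B ≤ Bstar := by
  have hqpos : ∀ i, 0 < q i := fun i => by
    have : (0 : ℝ) < q i := hq i ▸ by positivity
    exact_mod_cast this
  have hRstar : ∀ i, 0 ≤ Rstar i := fun i => by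
    have h1 : (1 : ℝ) ≤ q i := by exact_mod_cast hqpos i
    by_contra hneg
    have := Real.rpow_lt_one_of_one_lt_of_neg (one_lt_two : (1 : ℝ) < 2) (not_le.1 hneg)
    rw [← hq] at this
    linarith
  have hN : ∀ i : Fin K, (0 : ℝ) < K.choose (i + 1) := fun i =>
    Nat.cast_pos.2 (Nat.choose_pos i.2)
  set a : Fin K → ℝ := fun j => A j / K.choose (j + 1) with ha_def
  have ha : ∀ j, 0 ≤ a j := fun j => div_nonneg (hA j) (hN j).le
  set v : Fin K → ℝ := fun i => K.choose (i + 1) * bestExchangeValue a (i + 1) with hv_def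
  have hrate : ∀ i j : Fin K, exchangeRate K (i + 1) (j + 1) * A j =
      K.choose (i + 1) * (min 1 (((i + 1 : ℕ) : ℝ) / ((j : ℕ) + 1 : ℕ)) * a j) := fun i j => by
    rw [exchangeRate_eq (by omega) (by omega) i.2 j.2, ha_def]
    ring
  have hv : ∀ i j : Fin K, exchangeRate K (i + 1) (j + 1) * A j ≤ v i := fun i j => by
    rw [hrate]
    exact mul_le_mul_of_nonneg_left (le_bestExchangeValue _ j) (hN i).le
  have hg : ∀ i : Fin K, ∃ j : Fin K, exchangeRate K (i + 1) (j + 1) * A j = v i := fun i => by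
    have : Nonempty (Fin K) := ⟨i⟩
    obtain ⟨j, hj⟩ := exists_bestExchangeValue_eq (a := a) (i + 1)
    exact ⟨j, by simp only [hrate, hv_def, hj]⟩
  choose g hg using hg
  have hcompact := (isCompact_capacityRegion hq).image_of_continuousOn
    (f := fun R : Fin K → ℝ => ∑ k, A k * R k) (by fun_prop)
  obtain ⟨B, hB⟩ := hcompact.exists_isGreatest ⟨_, 0, zero_mem_capacityRegion hqpos, rfl⟩
  refine ⟨_, B, isGreatest_exchangeRegion hRstar hA g hv hg, hB, ?_⟩
  obtain ⟨R, hR, rfl⟩ := hB.1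
  have hnonneg : (0 : Fin K → ℝ) ≤ R :=
    closure_minimal (fun R hR => hR.1) (isClosed_Ici (a := (0 : Fin K → ℝ))) hR
  refine le_trans (Finset.sum_le_sum fun i _ => ?_)
    (weighted_rate_le_of_mem_capacityRegion hq bestExchangeValue_zero
      (bestExchangeValue_mono ha) (mul_bestExchangeValue_succ_le ha) hR)
  -- Keeping a level unexchanged has rate 1, hence `A i ≤ v i`.
  have h1 := hv i i
  rw [exchangeRate, if_neg (lt_irrefl _), if_neg (lt_irrefl _), one_mul] at h1
  exact mul_le_mul_of_nonneg_right h1 (hnonneg i)
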